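/- Let $m\ge 2$, $i,n\ge 0$ be integers. A partition of the $2\times n$ rectangle is a finite multiset of blocks (rectangles with positive integer side lengths, a $k\times l$ block being identified with an $l\times k$ block) such that the blocks can be placed in the plane, with sides parallel to the axes, so that they cover exactly the rectangle $[0,2]\times[0,n]$ and have pairwise disjoint interiors. Two partitions are the same if they are equal as multisets, regardless of the geometric arrangement; for $n=0$ the only partition is the empty one. Let $b_{i,0}(2,n)$ be the number of partitions of the $2\times n$ rectangle in which every block has one of the sizes $1\times 1, 1\times m,1\times m^2,\ldots,1\times m^i$. Write $n=\sum_{l=0}^{k}c_l m^l$ in base $m$, where $c_l\in\{0,1,\ldots,m-1\}$ for all $l$ and $c_s=0$ for $s>k$. If $m\ge 3$ and $i\ge 0$, then $$b_{i,0}(2,n)\equiv\prod_{l=1}^{i}(2c_l+1)\pmod m.$$ If $m=2$ and $i\ge 1$, then $$b_{i,0}(2,n)\equiv c_0+1\pmod 2.$$ -/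

import Mathlib

namespace RectPartition

/-- The rectangle `[x, x + a] × [y, y + b]` in the plane. -/
def rect (x y : ℝ) (a b : ℕ) : Set (ℝ × ℝ) :=
  Set.Icc x (x + a) ×ˢ Set.Icc y (y + b)

/-- A placed block: an axis-parallel rectangle with positive integer side lengths
at an arbitrary real position. -/
structure PlacedBlock where
  /-- first coordinate of the lower left corner -/
  x : ℝ
  /-- second coordinate of the lower left corner -/
  y : ℝ
  /-- side length in the first direction -/
  a : ℕ
  /-- side length in the second direction -/
  b : ℕ
  a_pos : 0 < a
  b_pos : 0 < b

/-- The region occupied by a placed block. -/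
def PlacedBlock.region (B : PlacedBlock) : Set (ℝ × ℝ) :=
  rect B.x B.y B.a B.b

/-- The size of a placed block, as an unordered pair: a block of size `k × l` is not
distinguished from a block of size `l × k`. -/
def PlacedBlock.size (B : PlacedBlock) : Sym2 ℕ :=
  s(B.a, B.b)

/-- The placed blocks `T 0, …, T (N - 1)` cover exactly the rectangle `[0, r] × [0, n]`, and their
interiors do not intersect. (If `r` and `n` are positive, the first two conditions say that the
union of the blocks is the rectangle. In this form they also make sense for the degenerate
rectangle, which is covered by the empty family of blocks.) -/
def IsTiling (r n : ℕ) {N : ℕ} (T : Fin N → PlacedBlock) : Prop :=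
  (∀ k, (T k).region ⊆ rect 0 0 r n) ∧
  interior (rect 0 0 r n) ⊆ ⋃ k, (T k).region ∧
  Pairwise fun k l => Disjoint (interior (T k).region) (interior (T l).region)

/-- A partition of the `r × n` rectangle: a multiset of block sizes such that blocks of these sizes
can be arranged to a tiling of the rectangle. -/
def IsPartition (r n : ℕ) (P : Multiset (Sym2 ℕ)) : Prop :=
  ∃ (N : ℕ) (T : Fin N → PlacedBlock),
    IsTiling r n T ∧ P = Finset.univ.val.map fun k => (T k).size

/-- The block sizes `1 × 1, 1 × m, …, 1 × m ^ i` and `2 × m, 2 × m ^ 2, …, 2 × m ^ j`. -/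
def allowedSizes (m i j : ℕ) : Set (Sym2 ℕ) :=
  {B | (∃ t, t ≤ i ∧ B = s(1, m ^ t)) ∨ (∃ t, 1 ≤ t ∧ t ≤ j ∧ B = s(2, m ^ t))}

/-- `b m i j n` is the number `b_{i,j}(2,n)` of partitions of the `2 × n` rectangle that only use
blocks of sizes `1 × 1, …, 1 × m ^ i` and `2 × m, …, 2 × m ^ j`. -/
noncomputable def b (m i j n : ℕ) : ℕ :=
  {P : Multiset (Sym2 ℕ) | IsPartition 2 n P ∧ ∀ B ∈ P, B ∈ allowedSizes m i j}.ncard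

end RectPartition

namespace RectPartition

/-! Every admissible block has a side of length one, so in a tiling of the `2 × n` rectangle it has
width one or is a `2 × 1` block laid across. Two vertical lines in general position, at distance
one, sort the blocks of width one into two rows of equal total length (`IsTiling.exists_split`). A
block across needs `m ^ s = 2`, hence `m = 2`.

For `m ≥ 3` the question is which counts `a s` of blocks `1 × m ^ s` split into two rows of length
`n`. The blocks of size at least `m ^ t` in one row have total length a multiple of `m ^ t`, hence
at most `m ^ t * (n / m ^ t)`. So with `M t = 2 * (n / m ^ t)` the tail of the counts from `t` is at
most `m ^ t * M t`, with equality for `t = 0`. Placing large blocks first shows that these bounds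
suffice (`exists_split_counts`). For `m = 2` a block across removes the bound at `t = 1`, so `M 1 =
n`.

Fixing the top count `v ≤ M i` lowers each `M t` with `t < i` by a multiple of `m`. By induction the
number of solutions is `∏ (M l + 1)` modulo `m` (`exists_finset_boundedCounts`). Finally `n / m ^ l
≡ c l`; for `m = 2` every factor except `l = 1` is odd. -/

/-! ### Vertical lines through a tiling. -/

theorem interior_rect (x y : ℝ) (a b : ℕ) :
    interior (rect x y a b) = Set.Ioo x (x + a) ×ˢ Set.Ioo y (y + b) := by
  rw [rect, interior_prod_eq, interior_Icc, interior_Icc]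

/-- Closed intervals with disjoint interiors that fill an interval have the right total length. -/
theorem sum_length_eq {ι : Type*} (s : Finset ι) (y : ι → ℝ) (b : ι → ℕ) (n : ℕ)
    (hsub : ∀ k ∈ s, Set.Ioo (y k) (y k + b k) ⊆ Set.Icc 0 (n : ℝ))
    (hcov : Set.Ioo 0 (n : ℝ) ⊆ ⋃ k ∈ s, Set.Icc (y k) (y k + b k))
    (hdis : ∀ k ∈ s, ∀ l ∈ s, k ≠ l →
      Disjoint (Set.Ioo (y k) (y k + b k)) (Set.Ioo (y l) (y l + b l))) :
    ∑ k ∈ s, b k = n := by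
  have h1 : ∑ k ∈ s, (b k : ENNReal) ≤ n := by
    have h := MeasureTheory.measure_biUnion_finset (μ := MeasureTheory.volume) (s := s)
      (f := fun k => Set.Ioo (y k) (y k + b k)) (fun k hk l hl h => hdis k hk l hl h)
      (fun _ _ => measurableSet_Ioo)
    have h' := MeasureTheory.measure_mono (μ := MeasureTheory.volume) (Set.iUnion₂_subset hsub)
    rw [h] at h'
    simpa using h'
  have h2 : (n : ENNReal) ≤ ∑ k ∈ s, (b k : ENNReal) := by
    have h := (MeasureTheory.measure_mono (μ := MeasureTheory.volume) hcov).trans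
      (MeasureTheory.measure_biUnion_finset_le s _)
    simpa using h
  exact_mod_cast le_antisymm h1 h2

/-- A line `x = ξ` in general position meets blocks of total height `n`. -/
theorem IsTiling.sum_line {r n N : ℕ} {T : Fin N → PlacedBlock} (hT : IsTiling r n T) {ξ : ℝ}
    (h0 : 0 < ξ) (hr : ξ < r) (hξ : ∀ k, ξ ≠ (T k).x ∧ ξ ≠ (T k).x + (T k).a)
    (s : Finset (Fin N)) (hs : ∀ k, k ∈ s ↔ (T k).x < ξ ∧ ξ < (T k).x + (T k).a) :
    ∑ k ∈ s, (T k).b = n := by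
  obtain ⟨hsub, hcov, hdis⟩ := hT
  apply sum_length_eq s (fun k => (T k).y)
  · intro k hk z hz
    have hk := (hs k).1 hk
    have : ((ξ, z) : ℝ × ℝ) ∈ rect 0 0 r n :=
      hsub k ⟨⟨hk.1.le, hk.2.le⟩, ⟨hz.1.le, hz.2.le⟩⟩
    simpa using this.2
  · intro z hz
    have : ((ξ, z) : ℝ × ℝ) ∈ interior (rect 0 0 r n) := by
      rw [interior_rect]
      exact ⟨⟨h0, by simpa using hr⟩, ⟨hz.1, by simpa using hz.2⟩⟩
    obtain ⟨k, hk⟩ := Set.mem_iUnion.1 (hcov this)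
    refine Set.mem_iUnion₂.2 ⟨k, (hs k).2 ⟨?_, ?_⟩, hk.2⟩
    · exact lt_of_le_of_ne hk.1.1 (hξ k).1.symm
    · exact lt_of_le_of_ne hk.1.2 (hξ k).2
  · intro k hk l hl hkl
    have := hdis hkl
    rw [Set.disjoint_left]
    intro z hz hz'
    refine (Set.disjoint_left.1 this : ∀ ⦃p⦄, _) (show (ξ, z) ∈ _ from ?_) ?_
    · rw [PlacedBlock.region, interior_rect]
      exact ⟨(hs k).1 hk, hz⟩
    · rw [PlacedBlock.region, interior_rect]
      exact ⟨(hs l).1 hl, hz'⟩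

theorem IsTiling.bounds {r n N : ℕ} {T : Fin N → PlacedBlock} (hT : IsTiling r n T) (k : Fin N) :
    0 ≤ (T k).x ∧ (T k).x + (T k).a ≤ r := by
  have h1 : (((T k).x, (T k).y) : ℝ × ℝ) ∈ rect 0 0 r n :=
    hT.1 k ⟨⟨le_rfl, by simp⟩, ⟨le_rfl, by simp⟩⟩
  have h2 : (((T k).x + (T k).a, (T k).y) : ℝ × ℝ) ∈ rect 0 0 r n :=
    hT.1 k ⟨⟨by simp, le_rfl⟩, ⟨le_rfl, by simp⟩⟩
  exact ⟨h1.1.1, by simpa using h2.1.2⟩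

theorem IsTiling.exists_split {n N : ℕ} {T : Fin N → PlacedBlock} (hT : IsTiling 2 n T)
    (h1 : ∀ k, ∃ l, (T k).size = s(1, l)) :
    ∃ (U V : Multiset ℕ) (v : ℕ), U.sum + v = n ∧ V.sum + v = n ∧
      Finset.univ.val.map (fun k => (T k).size) =
        U.map (fun l => s(1, l)) + V.map (fun l => s(1, l)) + Multiset.replicate v s(2, 1) := by
  have hab : ∀ k, (T k).a = 1 ∨ ((T k).a = 2 ∧ (T k).b = 1) := by
    intro k
    obtain ⟨l, hl⟩ := h1 k
    have hb := hT.bounds k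
    have : ((T k).a : ℝ) ≤ (2 : ℕ) := by linarith
    have h2 : (T k).a ≤ 2 := by exact_mod_cast this
    have h3 := (T k).a_pos
    simp only [PlacedBlock.size, Sym2.eq_iff] at hl
    omega
  let bad : Finset ℝ := Finset.univ.biUnion fun k : Fin N =>
    {(T k).x, (T k).x + (T k).a, (T k).x - 1, (T k).x + (T k).a - 1}
  -- The shifts by one in `bad` make both lines `δ` and `1 + δ` avoid all vertical sides, although
  -- positions are arbitrary reals.
  obtain ⟨δ, hδ, hbad⟩ := (Set.Ioo_infinite (zero_lt_one (α := ℝ))).exists_notMem_finset bad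
  simp only [bad, Finset.mem_biUnion, Finset.mem_univ, true_and, Finset.mem_insert,
    Finset.mem_singleton, not_exists, not_or] at hbad
  classical
  let X : Finset (Fin N) := Finset.univ.filter fun k => (T k).a = 2
  -- A block of width one has `0 ≤ x ≤ 1`: it meets the line `δ` if `x < δ` and the line `1 + δ`
  -- otherwise, never both. Blocks of width two meet both.
  let L : Finset (Fin N) := Finset.univ.filter fun k => (T k).a ≠ 2 ∧ (T k).x < δ
  let R : Finset (Fin N) := Finset.univ.filter fun k => (T k).a ≠ 2 ∧ ¬ (T k).x < δ
  have hLX : Disjoint L X := by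
    rw [Finset.disjoint_left]; intro k; simp [L, X]; tauto
  have hRX : Disjoint R X := by
    rw [Finset.disjoint_left]; intro k; simp [R, X]; tauto
  have hX : ∑ k ∈ X, (T k).b = X.card := by
    rw [Finset.card_eq_sum_ones]
    refine Finset.sum_congr rfl fun k hk => ?_
    have := (Finset.mem_filter.1 hk).2
    have := hab k
    omega
  have hleft := hT.sum_line (ξ := δ) hδ.1 (by norm_num; linarith [hδ.2])
    (fun k => ⟨(hbad k).1, (hbad k).2.1⟩) (L ∪ X) (by
      intro k
      have hb := hT.bounds k
      simp only [Finset.mem_union, L, X, Finset.mem_filter, Finset.mem_univ, true_and]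
      rcases hab k with h | ⟨h, -⟩
      · simp only [h] at hb ⊢
        norm_num at hb ⊢
        intro; linarith [hδ.2]
      · simp only [h] at hb ⊢
        norm_num at hb ⊢
        constructor <;> linarith [hδ.1, hδ.2])
  have hright := hT.sum_line (ξ := 1 + δ) (by linarith [hδ.1]) (by norm_num; linarith [hδ.2])
    (fun k => ⟨fun h => (hbad k).2.2.1 (by linarith), fun h => (hbad k).2.2.2 (by linarith)⟩)
    (R ∪ X) (by
      intro k
      have hb := hT.bounds k
      simp only [Finset.mem_union, R, X, Finset.mem_filter, Finset.mem_univ, true_and]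
      rcases hab k with h | ⟨h, -⟩
      · have hne := (hbad k).1
        simp only [h] at hb ⊢
        norm_num at hb ⊢
        constructor
        · intro h'
          have := lt_of_le_of_ne h' hne
          constructor <;> linarith [hδ.1]
        · intro h'; linarith [h'.2]
      · simp only [h] at hb ⊢
        norm_num at hb ⊢
        constructor <;> linarith [hδ.1, hδ.2])
  rw [Finset.sum_union hLX, hX] at hleft
  rw [Finset.sum_union hRX, hX] at hright
  refine ⟨L.val.map fun k => (T k).b, R.val.map fun k => (T k).b, X.card, hleft, hright, ?_⟩
  have hLR : Disjoint L R := by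
    rw [Finset.disjoint_left]; intro k; simp [L, R]; tauto
  have hU : (Finset.univ : Finset (Fin N)).val = L.val + R.val + X.val := by
    have hd : Disjoint (L.disjUnion R hLR) X := by
      rw [Finset.disjUnion_eq_union]; exact Finset.disjoint_union_left.2 ⟨hLX, hRX⟩
    have : (Finset.univ : Finset (Fin N)) = (L.disjUnion R hLR).disjUnion X hd := by
      ext k; simp only [Finset.disjUnion_eq_union, Finset.mem_union, L, R, X, Finset.mem_filter,
        Finset.mem_univ, true_and]; tauto
    rw [this]; rfl
  rw [hU, Multiset.map_add, Multiset.map_add, Multiset.map_map, Multiset.map_map]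
  have hone : ∀ k, (T k).a ≠ 2 → (T k).size = s(1, (T k).b) := by
    intro k hk
    have : (T k).a = 1 := by have := hab k; omega
    simp [PlacedBlock.size, this]
  congr 1
  · congr 1
    · exact Multiset.map_congr rfl fun k hk => hone k (Finset.mem_filter.1 (Finset.mem_val ▸ hk)).2.1
    · exact Multiset.map_congr rfl fun k hk => hone k (Finset.mem_filter.1 (Finset.mem_val ▸ hk)).2.1
  · rw [Multiset.eq_replicate]
    refine ⟨by simp, ?_⟩
    intro B hB
    obtain ⟨k, hk, rfl⟩ := Multiset.mem_map.1 hB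
    have h2 := (Finset.mem_filter.1 (Finset.mem_val ▸ hk)).2
    have : (T k).b = 1 := by have := hab k; omega
    simp [PlacedBlock.size, this, h2]

/-! ### Constructing tilings from lists of blocks. -/

/-- The blocks of the list tile the rectangle; the half-open rectangle is covered, so that the
degenerate rectangles are tiled by the empty list. -/
structure ListTiles (x y : ℝ) (a b : ℕ) (L : List PlacedBlock) : Prop where
  sub : ∀ B ∈ L, B.region ⊆ rect x y a b
  cov : Set.Ico x (x + a) ×ˢ Set.Ico y (y + b) ⊆ ⋃ B ∈ L, B.region
  dis : L.Pairwise fun B C => Disjoint (interior B.region) (interior C.region)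

theorem ListTiles.append {x y x₁ y₁ x₂ y₂ : ℝ} {a b a₁ b₁ a₂ b₂ : ℕ} {L₁ L₂ : List PlacedBlock}
    (h₁ : ListTiles x₁ y₁ a₁ b₁ L₁) (h₂ : ListTiles x₂ y₂ a₂ b₂ L₂)
    (hsub₁ : rect x₁ y₁ a₁ b₁ ⊆ rect x y a b) (hsub₂ : rect x₂ y₂ a₂ b₂ ⊆ rect x y a b)
    (hcov : Set.Ico x (x + a) ×ˢ Set.Ico y (y + b) ⊆
      Set.Ico x₁ (x₁ + a₁) ×ˢ Set.Ico y₁ (y₁ + b₁) ∪ Set.Ico x₂ (x₂ + a₂) ×ˢ Set.Ico y₂ (y₂ + b₂))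
    (hdis : Disjoint (interior (rect x₁ y₁ a₁ b₁)) (interior (rect x₂ y₂ a₂ b₂))) :
    ListTiles x y a b (L₁ ++ L₂) where
  sub := by
    intro B hB
    rcases List.mem_append.1 hB with h | h
    · exact (h₁.sub B h).trans hsub₁
    · exact (h₂.sub B h).trans hsub₂
  cov := by
    intro p hp
    rcases hcov hp with h | h
    · obtain ⟨B, hB, hpB⟩ := Set.mem_iUnion₂.1 (h₁.cov h)
      exact Set.mem_iUnion₂.2 ⟨B, List.mem_append_left _ hB, hpB⟩
    · obtain ⟨B, hB, hpB⟩ := Set.mem_iUnion₂.1 (h₂.cov h)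
      exact Set.mem_iUnion₂.2 ⟨B, List.mem_append_right _ hB, hpB⟩
  dis := List.pairwise_append.2 ⟨h₁.dis, h₂.dis, fun B hB C hC =>
    hdis.mono (interior_mono (h₁.sub B hB)) (interior_mono (h₂.sub C hC))⟩

theorem ListTiles.append_vertical {x y : ℝ} {a b₁ b₂ : ℕ} {L₁ L₂ : List PlacedBlock}
    (h₁ : ListTiles x y a b₁ L₁) (h₂ : ListTiles x (y + b₁) a b₂ L₂) :
    ListTiles x y a (b₁ + b₂) (L₁ ++ L₂) := by
  have hb₁ : (0 : ℝ) ≤ b₁ := by positivity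
  have hb₂ : (0 : ℝ) ≤ b₂ := by positivity
  refine h₁.append h₂ ?_ ?_ ?_ ?_
  · rintro p ⟨h, h'⟩
    exact ⟨h, h'.1, by push_cast; linarith [h'.2]⟩
  · rintro p ⟨h, h'⟩
    exact ⟨h, by linarith [h'.1], by push_cast; linarith [h'.2]⟩
  · rintro p ⟨h, h'⟩
    push_cast at h'
    by_cases hp : p.2 < y + b₁
    · exact Or.inl ⟨h, h'.1, hp⟩
    · exact Or.inr ⟨h, not_lt.1 hp, by linarith [h'.2]⟩
  · rw [interior_rect, interior_rect, Set.disjoint_left]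
    rintro p ⟨-, h⟩ ⟨-, h'⟩
    linarith [h.2, h'.1]

theorem ListTiles.append_horizontal {x y : ℝ} {a₁ a₂ b : ℕ} {L₁ L₂ : List PlacedBlock}
    (h₁ : ListTiles x y a₁ b L₁) (h₂ : ListTiles (x + a₁) y a₂ b L₂) :
    ListTiles x y (a₁ + a₂) b (L₁ ++ L₂) := by
  have ha₁ : (0 : ℝ) ≤ a₁ := by positivity
  have ha₂ : (0 : ℝ) ≤ a₂ := by positivity
  refine h₁.append h₂ ?_ ?_ ?_ ?_
  · rintro p ⟨h, h'⟩
    exact ⟨⟨h.1, by push_cast; linarith [h.2]⟩, h'⟩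
  · rintro p ⟨h, h'⟩
    exact ⟨⟨by linarith [h.1], by push_cast; linarith [h.2]⟩, h'⟩
  · rintro p ⟨h, h'⟩
    push_cast at h
    by_cases hp : p.1 < x + a₁
    · exact Or.inl ⟨⟨h.1, hp⟩, h'⟩
    · exact Or.inr ⟨⟨not_lt.1 hp, by linarith [h.2]⟩, h'⟩
  · rw [interior_rect, interior_rect, Set.disjoint_left]
    rintro p ⟨h, -⟩ ⟨h', -⟩
    linarith [h.2, h'.1]

theorem exists_column (a : ℕ) (ha : 0 < a) (x : ℝ) (l : List ℕ) (hl : ∀ k ∈ l, 0 < k) (y : ℝ) :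
    ∃ L, ListTiles x y a l.sum L ∧ L.map PlacedBlock.size = l.map fun k => s(a, k) := by
  induction l generalizing y with
  | nil => exact ⟨[], ⟨by simp, by simp, by simp⟩, by simp⟩
  | cons k l ih =>
    obtain ⟨L, hL, hs⟩ := ih (fun j hj => hl j (by simp [hj])) (y + k)
    have hB : ListTiles x y a k [⟨x, y, a, k, ha, hl k (by simp)⟩] := by
      refine ⟨by simp [PlacedBlock.region], ?_, by simp⟩
      simp only [List.mem_singleton, Set.iUnion_iUnion_eq_left, PlacedBlock.region, rect]
      exact Set.prod_mono Set.Ico_subset_Icc_self Set.Ico_subset_Icc_self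
    refine ⟨_, by simpa using hB.append_vertical hL, ?_⟩
    simp [hs, PlacedBlock.size]

theorem ListTiles.isPartition {r n : ℕ} {L : List PlacedBlock} (h : ListTiles 0 0 r n L) :
    IsPartition r n (L.map PlacedBlock.size : List (Sym2 ℕ)) := by
  refine ⟨L.length, L.get, ⟨fun k => h.sub _ (List.get_mem L k), ?_, ?_⟩, ?_⟩
  · rw [interior_rect]
    refine (Set.prod_mono Set.Ioo_subset_Ico_self Set.Ioo_subset_Ico_self).trans
      (h.cov.trans ?_)
    intro p hp
    obtain ⟨B, hB, hpB⟩ := Set.mem_iUnion₂.1 hp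
    obtain ⟨k, rfl⟩ := List.get_of_mem hB
    exact Set.mem_iUnion.2 ⟨k, hpB⟩
  · intro k l hkl
    rcases lt_or_gt_of_ne hkl with h' | h'
    · exact List.pairwise_iff_get.1 h.dis _ _ h'
    · exact (List.pairwise_iff_get.1 h.dis _ _ h').symm
  · rw [Fin.univ_val_map]
    congr 1
    conv_lhs => rw [← List.ofFn_get L]
    rw [List.map_ofFn]
    rfl

/-- Partitions of the `2 × n` rectangle into blocks of width one: two rows, after removing the
blocks which are placed across. -/
theorem isPartition_two_iff {n : ℕ} {P : Multiset (Sym2 ℕ)}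
    (hP : ∀ B ∈ P, ∃ l, 0 < l ∧ B = s(1, l)) :
    IsPartition 2 n P ↔ ∃ (U V : Multiset ℕ) (v : ℕ), U.sum + v = n ∧ V.sum + v = n ∧
      P = U.map (fun l => s(1, l)) + V.map (fun l => s(1, l)) + Multiset.replicate v s(2, 1) := by
  constructor
  · rintro ⟨N, T, hT, rfl⟩
    refine hT.exists_split fun k => ?_
    obtain ⟨l, -, h⟩ := hP (T k).size (Multiset.mem_map_of_mem _ (Finset.mem_univ k))
    exact ⟨l, h⟩
  · rintro ⟨U, V, v, hU, hV, rfl⟩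
    have pos : ∀ l, s(1, l) ∈ U.map (fun l => s(1, l)) + V.map (fun l => s(1, l)) +
        Multiset.replicate v s(2, 1) → 0 < l := by
      intro l hl
      obtain ⟨k, hk, h⟩ := hP _ hl
      rw [Sym2.eq_iff] at h
      omega
    induction U using Quotient.inductionOn with | h u => ?_
    induction V using Quotient.inductionOn with | h w => ?_
    obtain ⟨L₁, h₁, s₁⟩ := exists_column 1 one_pos 0 u (fun k hk => pos k (by
      simp only [Multiset.mem_add]
      exact Or.inl (Or.inl (Multiset.mem_map_of_mem _ hk)))) 0
    obtain ⟨L₂, h₂, s₂⟩ := exists_column 1 one_pos 1 w (fun k hk => pos k (by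
      simp only [Multiset.mem_add]
      exact Or.inl (Or.inr (Multiset.mem_map_of_mem _ hk)))) 0
    -- The blocks across are stacked on top of the two columns, which have equal height.
    obtain ⟨L₃, h₃, s₃⟩ := exists_column 2 two_pos 0 (List.replicate v 1)
      (by simp [List.mem_replicate]) (u.sum : ℝ)
    simp only [Multiset.quot_mk_to_coe, Multiset.sum_coe] at hU hV
    have huw : w.sum = u.sum := by omega
    rw [huw] at h₂
    have h12 : ListTiles 0 0 (1 + 1) u.sum (L₁ ++ L₂) := h₁.append_horizontal (by simpa using h₂)
    have h := h12.append_vertical (b₂ := v) (L₂ := L₃) (by simpa using h₃)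
    rw [hU] at h
    have := h.isPartition
    simp only [List.map_append, s₁, s₂, s₃, List.map_replicate] at this
    simpa [← Multiset.coe_add, ← Multiset.coe_replicate, add_assoc] using this


/-! ### Distributing powers of `m` over two rows. -/

open Finset in
/-- A family of `a s` parts `m ^ s` is divided into a part of sum `N₁` and a part of sum `N₂`
by placing the large parts first. -/
theorem exists_split_counts {m : ℕ} (hm : 0 < m) (i : ℕ) (N₁ N₂ : ℕ) (a : ℕ → ℕ)
    (hsum : ∑ s ∈ range (i + 1), a s * m ^ s = N₁ + N₂)
    (htail : ∀ t, 1 ≤ t → t ≤ i →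
      ∑ s ∈ Ico t (i + 1), a s * m ^ s ≤ m ^ t * (N₁ / m ^ t + N₂ / m ^ t)) :
    ∃ u : ℕ → ℕ, (∀ s, u s ≤ a s) ∧ ∑ s ∈ range (i + 1), u s * m ^ s = N₁ := by
  induction i generalizing N₁ N₂ with
  | zero =>
    refine ⟨fun s => if s = 0 then N₁ else 0, fun s => ?_, by simp⟩
    simp at hsum
    by_cases h : s = 0
    · subst h; simp; omega
    · simp [h]
  | succ i ih =>
    have htop := htail (i + 1) (by omega) le_rfl
    have hp : 0 < m ^ (i + 1) := by positivity
    simp only [Nat.Ico_succ_singleton, sum_singleton] at htop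
    rw [mul_comm] at htop
    have htop := Nat.le_of_mul_le_mul_left htop hp
    -- Greedy choice: as many of the largest parts as fit go into the first row, and `htop` makes
    -- the others fit into the second.
    obtain ⟨p, q, hpq, hp₁, hq₂⟩ : ∃ p q, p + q = a (i + 1) ∧ p ≤ N₁ / m ^ (i + 1) ∧
        q ≤ N₂ / m ^ (i + 1) := by
      generalize N₁ / m ^ (i + 1) = q₁ at *
      generalize N₂ / m ^ (i + 1) = q₂ at *
      exact ⟨min (a (i + 1)) q₁, a (i + 1) - min (a (i + 1)) q₁,
        by omega, by omega, by omega⟩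
    obtain ⟨K₁, rfl⟩ := Nat.exists_eq_add_of_le ((Nat.le_div_iff_mul_le hp).1 hp₁)
    obtain ⟨K₂, rfl⟩ := Nat.exists_eq_add_of_le ((Nat.le_div_iff_mul_le hp).1 hq₂)
    obtain ⟨u, hu, hus⟩ := ih K₁ K₂ (by
      rw [sum_range_succ, ← hpq, add_mul] at hsum
      omega) (by
      intro t h1 h2
      have h := htail t h1 (by omega)
      rw [sum_Ico_succ_top (by omega)] at h
      have hpow : m ^ (i + 1) = m ^ t * m ^ (i + 1 - t) := by rw [← pow_add]; congr 1; omega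
      -- Since `m ^ t` divides `m ^ (i + 1)`, removing the largest parts lowers both sides of the
      -- tail bound at `t` by the same amount.
      have hdiv : ∀ p K, (p * m ^ (i + 1) + K) / m ^ t = p * m ^ (i + 1 - t) + K / m ^ t := by
        intro p K
        rw [hpow, show p * (m ^ t * m ^ (i + 1 - t)) + K = K + m ^ t * (p * m ^ (i + 1 - t)) by ring,
          Nat.add_mul_div_left _ _ (by positivity), add_comm]
      rw [hdiv, hdiv, ← hpq] at h
      have e : m ^ t * (p * m ^ (i + 1 - t) + K₁ / m ^ t + (q * m ^ (i + 1 - t) + K₂ / m ^ t)) =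
          m ^ t * (K₁ / m ^ t + K₂ / m ^ t) + (p + q) * m ^ (i + 1) := by rw [hpow]; ring
      rw [e] at h
      omega)
    refine ⟨Function.update u (i + 1) p, fun s => ?_, ?_⟩
    · by_cases h : s = i + 1
      · subst h; simp; omega
      · simp [h, hu s]
    · rw [sum_range_succ, ← hus]
      simp only [Function.update_self]
      rw [add_comm]
      congr 1
      refine sum_congr rfl fun s hs => ?_
      rw [Function.update_of_ne]
      have := mem_range.1 hs
      omega

open Finset in
theorem tail_le_div {m : ℕ} (hm : 0 < m) (i N t : ℕ) (u : ℕ → ℕ)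
    (h : ∑ s ∈ range (i + 1), u s * m ^ s ≤ N) :
    ∑ s ∈ Ico t (i + 1), u s * m ^ s ≤ m ^ t * (N / m ^ t) := by
  have hd : m ^ t ∣ ∑ s ∈ Ico t (i + 1), u s * m ^ s :=
    dvd_sum fun s hs => Dvd.dvd.mul_left (pow_dvd_pow m (mem_Ico.1 hs).1) _
  obtain ⟨c, hc⟩ := hd
  have hle : ∑ s ∈ Ico t (i + 1), u s * m ^ s ≤ N :=
    le_trans (sum_le_sum_of_subset (fun s hs => by
      rw [mem_range]; exact (mem_Ico.1 hs).2)) h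
  rw [hc] at hle ⊢
  have hp : 0 < m ^ t := by positivity
  exact Nat.mul_le_mul_left _ ((Nat.le_div_iff_mul_le hp).2 (by rwa [mul_comm]))

/-! ### Counting bounded sequences modulo `m`. -/

/-- Sequences `a 0, …, a i` with `∑ a s * m ^ s = M 0` and with tails bounded by `m ^ t * M t`. -/
def BoundedCounts (m i : ℕ) (M : ℕ → ℕ) (a : ℕ → ℕ) : Prop :=
  (∀ s, i < s → a s = 0) ∧ ∑ s ∈ Finset.range (i + 1), a s * m ^ s = M 0 ∧
    ∀ t, 1 ≤ t → t ≤ i → ∑ s ∈ Finset.Ico t (i + 1), a s * m ^ s ≤ m ^ t * M t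

open Finset in
-- The top term equals `m ^ t` times `a (i + 1) * m ^ (i + 1 - t)`, so it can be moved into the
-- bound at `t`. By `hM` the natural subtraction does not truncate once `a (i + 1) ≤ M (i + 1)`.
theorem boundedCounts_succ_iff {m : ℕ} (hm : 0 < m) (i : ℕ) (M a : ℕ → ℕ)
    (hM : ∀ t, t ≤ i → m * M (t + 1) ≤ M t) :
    BoundedCounts m (i + 1) M a ↔ a (i + 1) ≤ M (i + 1) ∧
      BoundedCounts m i (fun t => M t - a (i + 1) * m ^ (i + 1 - t))
        (Function.update a (i + 1) 0) := by
  have hp : 0 < m ^ (i + 1) := by positivity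
  have hpow : ∀ t, t ≤ i + 1 → m ^ (i + 1) = m ^ t * m ^ (i + 1 - t) := fun t ht => by
    rw [← pow_add]; congr 1; omega
  have hMt : ∀ d t, t + d = i + 1 → M (i + 1) * m ^ d ≤ M t := by
    intro d
    induction d with
    | zero => intro t ht; simp at ht; simp [ht]
    | succ d ih =>
      intro t ht
      have := ih (t + 1) (by omega)
      calc M (i + 1) * m ^ (d + 1) = m * (M (i + 1) * m ^ d) := by ring
        _ ≤ m * M (t + 1) := Nat.mul_le_mul_left _ this
        _ ≤ M t := hM t (by omega)
  have hcongr : ∀ t, ∑ s ∈ Ico t (i + 1), Function.update a (i + 1) 0 s * m ^ s =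
      ∑ s ∈ Ico t (i + 1), a s * m ^ s := fun t => sum_congr rfl fun s hs => by
    rw [Function.update_of_ne]
    have := (mem_Ico.1 hs).2
    omega
  have hrange : ∀ t, t ≤ i → ∑ s ∈ Ico t (i + 1 + 1), a s * m ^ s =
      ∑ s ∈ Ico t (i + 1), a s * m ^ s + a (i + 1) * m ^ (i + 1) := fun t ht =>
    sum_Ico_succ_top (by omega) _
  have hle : ∀ t, t ≤ i → a (i + 1) ≤ M (i + 1) → a (i + 1) * m ^ (i + 1 - t) ≤ M t :=
    fun t ht h => (Nat.mul_le_mul_right _ h).trans (hMt _ t (by omega))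
  have hzero : (∀ s, i < s → Function.update a (i + 1) 0 s = 0) ↔ ∀ s, i + 1 < s → a s = 0 := by
    constructor
    · intro h s hs
      have := h s (by omega)
      rwa [Function.update_of_ne (by omega)] at this
    · intro h s hs
      by_cases h' : s = i + 1
      · simp [h']
      · rw [Function.update_of_ne h']; exact h s (by omega)
  unfold BoundedCounts
  rw [hzero, range_eq_Ico, range_eq_Ico, hrange 0 (by omega)]
  simp only [hcongr]
  have htop : ∑ s ∈ Ico (i + 1) (i + 1 + 1), a s * m ^ s = a (i + 1) * m ^ (i + 1) := by simp
  constructor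
  · rintro ⟨h0, hs, ht⟩
    have h1 := ht (i + 1) (by omega) le_rfl
    rw [htop, mul_comm] at h1
    refine ⟨Nat.le_of_mul_le_mul_left h1 hp, h0, ?_, fun t h1 h2 => ?_⟩
    · rw [Nat.sub_zero]
      omega
    · have := ht t h1 (by omega)
      rw [hrange t h2] at this
      rw [Nat.mul_sub, mul_left_comm, ← hpow t (by omega)]
      omega
  · rintro ⟨ha, h0, hs, ht⟩
    refine ⟨h0, ?_, fun t h1 h2 => ?_⟩
    · have := hle 0 (by omega) ha
      rw [Nat.sub_zero] at hs this
      omega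
    · rcases Nat.lt_or_ge i t with h | h
      · obtain rfl : t = i + 1 := by omega
        rw [htop, mul_comm]
        exact Nat.mul_le_mul_left _ ha
      · rw [hrange t h]
        have h3 := ht t h1 h
        rw [Nat.mul_sub, mul_left_comm, ← hpow t (by omega)] at h3
        have h4 := Nat.mul_le_mul_left (m ^ t) (hle t h ha)
        rw [mul_left_comm, ← hpow t (by omega)] at h4
        omega

open Finset in
-- Each of the `M (i + 1) + 1` values of the top count leaves a problem for `i` whose bounds at `1,
-- …, i` are unchanged modulo `m`, so all values contribute the same residue.
theorem exists_finset_boundedCounts {m : ℕ} (hm : 0 < m) (i : ℕ) (M : ℕ → ℕ)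
    (hM : ∀ t, t < i → m * M (t + 1) ≤ M t) :
    ∃ F : Finset (ℕ → ℕ), (∀ a, a ∈ F ↔ BoundedCounts m i M a) ∧
      F.card ≡ ∏ l ∈ Icc 1 i, (M l + 1) [MOD m] := by
  classical
  induction i generalizing M with
  | zero =>
    refine ⟨{fun s => if s = 0 then M 0 else 0}, fun a => ?_, by simp; rfl⟩
    rw [mem_singleton, funext_iff, BoundedCounts]
    simp only [zero_add, sum_range_one, pow_zero, mul_one]
    constructor
    · intro h
      refine ⟨fun s hs => ?_, by simpa using h 0, by omega⟩
      rw [h s, if_neg (by omega)]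
    · rintro ⟨h, h0, -⟩ s
      by_cases hs : s = 0
      · simp [hs, h0]
      · simp [hs, h s (by omega)]
  | succ i ih =>
    have key : ∀ v, v ≤ M (i + 1) → ∃ F : Finset (ℕ → ℕ),
        (∀ a, a ∈ F ↔ BoundedCounts m i (fun t => M t - v * m ^ (i + 1 - t)) a) ∧
        F.card ≡ ∏ l ∈ Icc 1 i, (M l + 1) [MOD m] := by
      intro v hv
      obtain ⟨F, hF, hc⟩ := ih (fun t => M t - v * m ^ (i + 1 - t)) (by
        intro t ht
        rw [Nat.mul_sub]
        have : m * (v * m ^ (i + 1 - (t + 1))) = v * m ^ (i + 1 - t) := by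
          rw [show i + 1 - t = (i + 1 - (t + 1)) + 1 by omega, pow_succ]; ring
        rw [this]
        exact Nat.sub_le_sub_right (hM t (by omega)) _)
      refine ⟨F, hF, hc.trans ?_⟩
      have hMt : ∀ d t, t + d = i + 1 → v * m ^ d ≤ M t := by
        intro d
        induction d with
        | zero => intro t ht; simp at ht; simpa [ht] using hv
        | succ d ih =>
          intro t ht
          have := ih (t + 1) (by omega)
          calc v * m ^ (d + 1) = m * (v * m ^ d) := by ring
            _ ≤ m * M (t + 1) := Nat.mul_le_mul_left _ this
            _ ≤ M t := hM t (by omega)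
      rw [← ZMod.natCast_eq_natCast_iff]
      push_cast
      refine prod_congr rfl fun l hl => ?_
      have hl := mem_Icc.1 hl
      rw [Nat.cast_sub (hMt _ l (by omega))]
      -- The exponent is positive because `l ≤ i`, so the subtracted term vanishes in `ZMod m`.
      rw [show i + 1 - l = (i - l) + 1 by omega]
      simp [pow_succ]
    choose! F hF hc using key
    have hupd : ∀ v w (a a' : ℕ → ℕ), a ∈ F v → a' ∈ F w → v ≤ M (i + 1) → w ≤ M (i + 1) →
        Function.update a (i + 1) v = Function.update a' (i + 1) w → v = w ∧ a = a' := by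
      intro v w a a' ha ha' hv hw h
      have hvw : v = w := by simpa using congrFun h (i + 1)
      refine ⟨hvw, funext fun s => ?_⟩
      by_cases hs : s = i + 1
      · subst hs
        rw [((hF v hv a).1 ha).1 _ (by omega), ((hF w hw a').1 ha').1 _ (by omega)]
      · simpa [hs] using congrFun h s
    refine ⟨(range (M (i + 1) + 1)).biUnion fun v =>
      (F v).image fun a => Function.update a (i + 1) v, fun a => ?_, ?_⟩
    · rw [boundedCounts_succ_iff hm i M a fun t ht => hM t (by omega)]
      simp only [mem_biUnion, mem_range, mem_image]
      constructor
      · rintro ⟨v, hv, a, ha, rfl⟩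
        have hv : v ≤ M (i + 1) := by omega
        have ha := (hF v hv a).1 ha
        refine ⟨by simpa using hv, ?_⟩
        have h0 : Function.update a (i + 1) 0 = a := by
          rw [← ha.1 (i + 1) (by omega), Function.update_eq_self]
        simpa [h0] using ha
      · rintro ⟨hv, ha⟩
        exact ⟨a (i + 1), by omega, _, (hF _ hv _).2 ha, by simp⟩
    · rw [card_biUnion]
      · rw [← ZMod.natCast_eq_natCast_iff, prod_Icc_succ_top (by omega)]
        push_cast
        rw [sum_congr rfl (g := fun _ => ∏ l ∈ Icc 1 i, ((M l : ZMod m) + 1))]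
        · simp [mul_comm]
        · intro v hv
          have hv : v ≤ M (i + 1) := by have := mem_range.1 hv; omega
          rw [card_image_of_injOn fun a ha a' ha' h => (hupd v v a a' ha ha' hv hv h).2]
          have := (ZMod.natCast_eq_natCast_iff _ _ _).2 (hc v hv)
          simpa using this
      · intro v hv w hw hvw
        rw [Function.onFun, disjoint_left]
        intro b hb hb'
        obtain ⟨a, ha, rfl⟩ := mem_image.1 hb
        obtain ⟨a', ha', h⟩ := mem_image.1 hb'
        have := mem_range.1 hv
        have := mem_range.1 hw
        exact hvw (hupd v w a a' ha ha' (by omega) (by omega) h.symm).1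


/-! ### From multisets of blocks to counts. -/

/-- The multiset of `a s` blocks `1 × m ^ s` for `s ≤ i`. -/
def ofCounts (m i : ℕ) (a : ℕ → ℕ) : Multiset (Sym2 ℕ) :=
  ∑ s ∈ Finset.range (i + 1), Multiset.replicate (a s) s(1, m ^ s)

theorem one_sym_injective : Function.Injective fun l : ℕ => s(1, l) := by
  intro k l h
  simp only [Sym2.eq_iff] at h
  omega

theorem one_sym_pow_injective {m : ℕ} (hm : 2 ≤ m) : Function.Injective fun s : ℕ => s(1, m ^ s) :=
  one_sym_injective.comp (Nat.pow_right_injective hm)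

theorem count_sum_replicate {α : Type*} [DecidableEq α] {f : ℕ → α} (hf : Function.Injective f)
    {i t : ℕ} (ht : t ≤ i) (a : ℕ → ℕ) :
    (∑ s ∈ Finset.range (i + 1), Multiset.replicate (a s) (f s)).count (f t) = a t := by
  simp only [Multiset.count_sum', Multiset.count_replicate, hf.eq_iff]
  rw [Finset.sum_ite_eq', if_pos (Finset.mem_range.2 (by omega))]

theorem sum_replicate_count {α : Type*} [DecidableEq α] {f : ℕ → α} (hf : Function.Injective f)
    {i : ℕ} {X : Multiset α} (hX : ∀ x ∈ X, ∃ s, s ≤ i ∧ x = f s) :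
    ∑ s ∈ Finset.range (i + 1), Multiset.replicate (X.count (f s)) (f s) = X := by
  ext x
  by_cases hx : ∃ s, s ≤ i ∧ x = f s
  · obtain ⟨s, hs, rfl⟩ := hx
    exact count_sum_replicate hf hs fun s => X.count (f s)
  · rw [Multiset.count_eq_zero_of_notMem fun h => hx (hX x h), Multiset.count_sum']
    refine Finset.sum_eq_zero fun s hs => ?_
    rw [Multiset.count_replicate, if_neg]
    rintro rfl
    exact hx ⟨s, by have := Finset.mem_range.1 hs; omega, rfl⟩

theorem mem_ofCounts {m i : ℕ} {a : ℕ → ℕ} {B : Sym2 ℕ} (h : B ∈ ofCounts m i a) :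
    ∃ s, s ≤ i ∧ B = s(1, m ^ s) := by
  obtain ⟨s, hs, hB⟩ := Multiset.mem_sum.1 h
  exact ⟨s, by have := Finset.mem_range.1 hs; omega, Multiset.eq_of_mem_replicate hB⟩

theorem ofCounts_add (m i : ℕ) (a a' : ℕ → ℕ) :
    ofCounts m i (fun s => a s + a' s) = ofCounts m i a + ofCounts m i a' := by
  simp only [ofCounts, Multiset.replicate_add, Finset.sum_add_distrib]

theorem sum_sum_replicate (i : ℕ) (a f : ℕ → ℕ) :
    (∑ s ∈ Finset.range (i + 1), Multiset.replicate (a s) (f s)).sum =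
      ∑ s ∈ Finset.range (i + 1), a s * f s := by
  rw [← Multiset.coe_sumAddMonoidHom, map_sum]
  simp

theorem map_sum_replicate (m i : ℕ) (a : ℕ → ℕ) :
    (∑ s ∈ Finset.range (i + 1), Multiset.replicate (a s) (m ^ s)).map (fun l => s(1, l)) =
      ofCounts m i a := by
  rw [← Multiset.coe_mapAddMonoidHom, map_sum]
  simp [ofCounts]

theorem ofCounts_two (i v : ℕ) (hi : 1 ≤ i) :
    ofCounts 2 i (fun s => if s = 1 then v else 0) = Multiset.replicate v s(2, 1) := by
  rw [ofCounts, Finset.sum_eq_single 1]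
  · simp [Sym2.eq_swap]
  · intro s _ hs
    simp [hs]
  · intro h
    simp at h
    omega

theorem sym_two_one_eq_iff {m : ℕ} (hm : 2 ≤ m) (s : ℕ) :
    s(2, 1) = s(1, m ^ s) ↔ m = 2 ∧ s = 1 := by
  rw [Sym2.eq_iff]
  constructor
  · rintro (h | h)
    · omega
    · obtain rfl : s = 1 := by
        rcases s with _ | _ | s
        · simp at h
        · rfl
        · have h4 : 2 ^ 2 ≤ m ^ (s + 1 + 1) :=
            (Nat.pow_le_pow_left hm 2).trans (Nat.pow_le_pow_right (by omega) (by omega))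
          omega
      simpa using h.1.symm
  · rintro ⟨rfl, rfl⟩
    simp

/-- `IsPartition` in terms of the number of blocks of each size. -/
theorem isPartition_ofCounts_iff {m : ℕ} (hm : 2 ≤ m) (i n : ℕ) (a : ℕ → ℕ) :
    IsPartition 2 n (ofCounts m i a) ↔ ∃ (u w : ℕ → ℕ) (v : ℕ),
      ∑ s ∈ Finset.range (i + 1), u s * m ^ s + v = n ∧
      ∑ s ∈ Finset.range (i + 1), w s * m ^ s + v = n ∧
      (v = 0 ∨ (m = 2 ∧ 1 ≤ i)) ∧
      ∀ s, s ≤ i → a s = u s + w s + if m = 2 ∧ s = 1 then v else 0 := by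
  rw [isPartition_two_iff fun B hB => ?_]
  swap
  · obtain ⟨s, -, rfl⟩ := mem_ofCounts hB
    exact ⟨m ^ s, by positivity, rfl⟩
  constructor
  · rintro ⟨U, V, v, hU, hV, hP⟩
    have hmem : ∀ l, s(1, l) ∈ ofCounts m i a → ∃ s, s ≤ i ∧ l = m ^ s := by
      intro l hl
      obtain ⟨s, hs, h⟩ := mem_ofCounts hl
      exact ⟨s, hs, one_sym_injective h⟩
    have hinj : Function.Injective fun s : ℕ => m ^ s := Nat.pow_right_injective hm
    have hU' := sum_replicate_count hinj (i := i) (X := U) fun l hl => hmem l (by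
      rw [hP]
      simp only [Multiset.mem_add]
      exact Or.inl (Or.inl (Multiset.mem_map_of_mem _ hl)))
    have hV' := sum_replicate_count hinj (i := i) (X := V) fun l hl => hmem l (by
      rw [hP]
      simp only [Multiset.mem_add]
      exact Or.inl (Or.inr (Multiset.mem_map_of_mem _ hl)))
    refine ⟨fun s => U.count (m ^ s), fun s => V.count (m ^ s), v, ?_, ?_, ?_, fun s hs => ?_⟩
    · rw [← sum_sum_replicate i (fun s => U.count (m ^ s)) (fun s => m ^ s), hU', hU]
    · rw [← sum_sum_replicate i (fun s => V.count (m ^ s)) (fun s => m ^ s), hV', hV]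
    · refine or_iff_not_imp_left.2 fun hv => ?_
      obtain ⟨s, hs, h⟩ := mem_ofCounts (m := m) (i := i) (a := a) (B := s(2, 1)) (by
        rw [hP]
        exact Multiset.mem_add.2 (Or.inr (Multiset.mem_replicate.2 ⟨hv, rfl⟩)))
      have := (sym_two_one_eq_iff hm s).1 h
      omega
    · rw [← count_sum_replicate (one_sym_pow_injective hm) hs a]
      change (ofCounts m i a).count _ = _
      rw [hP, Multiset.count_add, Multiset.count_add, Multiset.count_replicate]
      rw [Multiset.count_map_eq_count' _ _ one_sym_injective,
        Multiset.count_map_eq_count' _ _ one_sym_injective]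
      simp only [sym_two_one_eq_iff hm s]
  · rintro ⟨u, w, v, hu, hw, hv, ha⟩
    refine ⟨_, _, v, (sum_sum_replicate i u fun s => m ^ s).symm ▸ hu,
      (sum_sum_replicate i w fun s => m ^ s).symm ▸ hw, ?_⟩
    have : ofCounts m i a = ofCounts m i fun s => u s + w s + if m = 2 ∧ s = 1 then v else 0 :=
      Finset.sum_congr rfl fun s hs => by
        rw [ha s (by have := Finset.mem_range.1 hs; omega)]
    rw [this, ofCounts_add, ofCounts_add, map_sum_replicate, map_sum_replicate]
    congr 1
    rcases hv with rfl | ⟨rfl, hi⟩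
    · simp [ofCounts]
    · simpa using ofCounts_two i v hi

/-! ### Tail bounds as a criterion for partitions. -/

theorem isPartition_iff_boundedCounts {m : ℕ} (hm : 3 ≤ m) (i n : ℕ) (a : ℕ → ℕ)
    (ha : ∀ s, i < s → a s = 0) :
    IsPartition 2 n (ofCounts m i a) ↔ BoundedCounts m i (fun t => 2 * (n / m ^ t)) a := by
  rw [isPartition_ofCounts_iff (by omega)]
  unfold BoundedCounts
  beta_reduce
  have hm0 : 0 < m := by omega
  constructor
  · rintro ⟨u, w, v, hu, hw, hv, h⟩
    obtain rfl : v = 0 := by omega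
    have hsplit : ∀ S ⊆ Finset.range (i + 1), ∑ s ∈ S, a s * m ^ s =
        ∑ s ∈ S, u s * m ^ s + ∑ s ∈ S, w s * m ^ s := by
      intro S hS
      rw [← Finset.sum_add_distrib]
      refine Finset.sum_congr rfl fun s hs => ?_
      rw [h s (by have := Finset.mem_range.1 (hS hs); omega)]
      simp [add_mul]
    refine ⟨ha, ?_, fun t _ _ => ?_⟩
    · rw [hsplit _ subset_rfl, pow_zero, Nat.div_one]
      omega
    · rw [hsplit _ (fun s hs => Finset.mem_range.2 (Finset.mem_Ico.1 hs).2), two_mul, mul_add]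
      exact add_le_add (tail_le_div hm0 i n t u (by omega)) (tail_le_div hm0 i n t w (by omega))
  · rintro ⟨-, hs, ht⟩
    rw [pow_zero, Nat.div_one] at hs
    obtain ⟨u, hu, hus⟩ := exists_split_counts hm0 i n n a (by omega)
      (fun t h1 h2 => by simpa only [two_mul] using ht t h1 h2)
    refine ⟨u, fun s => a s - u s, 0, by omega, ?_, Or.inl rfl, fun s _ => ?_⟩
    · have : ∑ s ∈ Finset.range (i + 1), u s * m ^ s +
          ∑ s ∈ Finset.range (i + 1), (a s - u s) * m ^ s = 2 * n := by
        rw [← hs, ← Finset.sum_add_distrib]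
        refine Finset.sum_congr rfl fun s _ => ?_
        rw [← add_mul, Nat.add_sub_cancel' (hu s)]
      beta_reduce
      omega
    · have := hu s
      simp
      omega

/-- At `t = 1` the bound `2 * n` already follows from the total, so nothing is required there. If
the two-row bound `4 * (n / 2)` fails, one block across repairs it. -/
theorem isPartition_iff_boundedCounts_two {i : ℕ} (hi : 1 ≤ i) (n : ℕ) (a : ℕ → ℕ)
    (ha : ∀ s, i < s → a s = 0) :
    IsPartition 2 n (ofCounts 2 i a) ↔
      BoundedCounts 2 i (fun t => if t = 1 then n else 2 * (n / 2 ^ t)) a := by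
  rw [isPartition_ofCounts_iff le_rfl]
  unfold BoundedCounts
  beta_reduce
  constructor
  · rintro ⟨u, w, v, hu, hw, hv, h⟩
    have hsplit : ∀ S ⊆ Finset.range (i + 1), ∑ s ∈ S, a s * 2 ^ s =
        ∑ s ∈ S, u s * 2 ^ s + ∑ s ∈ S, w s * 2 ^ s + if 1 ∈ S then v * 2 else 0 := by
      intro S hS
      have : (∑ s ∈ S, if s = 1 then v * 2 else 0) = if 1 ∈ S then v * 2 else 0 :=
        Finset.sum_ite_eq' _ _ _
      rw [← this, ← Finset.sum_add_distrib, ← Finset.sum_add_distrib]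
      refine Finset.sum_congr rfl fun s hs => ?_
      rw [h s (by have := Finset.mem_range.1 (hS hs); omega)]
      by_cases h1 : s = 1
      · subst h1; simp [add_mul]
      · simp [h1, add_mul]
    have htot : ∑ s ∈ Finset.range (i + 1), a s * 2 ^ s = 2 * n := by
      rw [hsplit _ subset_rfl, if_pos (Finset.mem_range.2 (by omega))]
      omega
    refine ⟨ha, by simpa using htot, fun t h1 h2 => ?_⟩
    have hsub : Finset.Ico t (i + 1) ⊆ Finset.range (i + 1) :=
      fun s hs => Finset.mem_range.2 (Finset.mem_Ico.1 hs).2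
    by_cases ht : t = 1
    · rw [if_pos ht, ht, pow_one, ← htot]
      rw [ht] at hsub
      exact Finset.sum_le_sum_of_subset hsub
    · rw [if_neg ht, hsplit _ hsub, if_neg (by rw [Finset.mem_Ico]; omega), add_zero,
        two_mul, mul_add]
      exact add_le_add (tail_le_div two_pos i n t u (by omega))
        (tail_le_div two_pos i n t w (by omega))
  · rintro ⟨-, hs, ht⟩
    have htot : ∑ s ∈ Finset.range (i + 1), a s * 2 ^ s = 2 * n := by simpa using hs
    have ht1 := ht 1 le_rfl hi
    rw [if_pos rfl, pow_one] at ht1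
    have ht2 : ∀ t, 2 ≤ t → t ≤ i →
        ∑ s ∈ Finset.Ico t (i + 1), a s * 2 ^ s ≤ 2 ^ t * (n / 2 ^ t + n / 2 ^ t) := by
      intro t h1 h2
      have := ht t (by omega) h2
      rwa [if_neg (by omega), two_mul] at this
    by_cases hcase : ∑ s ∈ Finset.Ico 1 (i + 1), a s * 2 ^ s ≤ 2 ^ 1 * (n / 2 ^ 1 + n / 2 ^ 1)
    · obtain ⟨u, hu, hus⟩ := exists_split_counts two_pos i n n a (by omega) (fun t h1 h2 => by
        rcases Nat.lt_or_ge 1 t with h | h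
        · exact ht2 t h h2
        · obtain rfl : t = 1 := by omega
          exact hcase)
      refine ⟨u, fun s => a s - u s, 0, by omega, ?_, Or.inl rfl, fun s _ => ?_⟩
      · have : ∑ s ∈ Finset.range (i + 1), u s * 2 ^ s +
            ∑ s ∈ Finset.range (i + 1), (a s - u s) * 2 ^ s = 2 * n := by
          rw [← htot, ← Finset.sum_add_distrib]
          refine Finset.sum_congr rfl fun s _ => ?_
          rw [← add_mul, Nat.add_sub_cancel' (hu s)]
        beta_reduce
        omega
      · have := hu s
        simp
        omega
    · have hfirst : ∑ s ∈ Finset.Ico 1 (i + 1), a s * 2 ^ s =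
          a 1 * 2 + ∑ s ∈ Finset.Ico 2 (i + 1), a s * 2 ^ s := by
        rw [Finset.sum_eq_sum_Ico_succ_bot (by omega), pow_one]
      obtain ⟨q, hq⟩ : 4 ∣ ∑ s ∈ Finset.Ico 2 (i + 1), a s * 2 ^ s :=
        Finset.dvd_sum fun s hs => Dvd.dvd.mul_left
          (pow_dvd_pow 2 (Finset.mem_Ico.1 hs).1 : 2 ^ 2 ∣ 2 ^ s) _
      -- The tail from `1` lies above `4 * (n / 2)` and is at most `2 * n`. The tail from `2` is a
      -- multiple of `4` and cannot lie there alone; so `n` is odd and a block `1 × 2` is available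
      -- to be laid across, leaving two rows of even length `2 * N`.
      have ha1 : 1 ≤ a 1 := by omega
      obtain ⟨N, rfl⟩ : ∃ N, n = 2 * N + 1 := ⟨n / 2, by omega⟩
      let a' : ℕ → ℕ := fun s => if s = 1 then a 1 - 1 else a s
      have haa : ∀ s, a s = a' s + if s = 1 then 1 else 0 := by
        intro s
        by_cases h : s = 1
        · subst h; simp [a']; omega
        · simp [a', h]
      have hsplit : ∀ S : Finset ℕ, ∑ s ∈ S, a s * 2 ^ s =
          ∑ s ∈ S, a' s * 2 ^ s + if 1 ∈ S then 2 else 0 := by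
        intro S
        have : (∑ s ∈ S, if s = 1 then 2 else 0) = if 1 ∈ S then 2 else 0 :=
          Finset.sum_ite_eq' _ _ _
        rw [← this, ← Finset.sum_add_distrib]
        refine Finset.sum_congr rfl fun s hs => ?_
        rw [haa s]
        by_cases h1 : s = 1
        · subst h1; simp [add_mul]
        · simp [h1]
      have htot' : ∑ s ∈ Finset.range (i + 1), a' s * 2 ^ s = 2 * N + 2 * N := by
        have := hsplit (Finset.range (i + 1))
        rw [if_pos (Finset.mem_range.2 (by omega))] at this
        omega
      obtain ⟨u, hu, hus⟩ := exists_split_counts two_pos i (2 * N) (2 * N) a' htot'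
        (fun t h1 h2 => by
          have := hsplit (Finset.Ico t (i + 1))
          rcases Nat.lt_or_ge 1 t with h | h
          · rw [if_neg (by rw [Finset.mem_Ico]; omega)] at this
            have h3 := ht2 t h h2
            have hdiv : (2 * N + 1) / 2 ^ t = 2 * N / 2 ^ t := by
              obtain ⟨r, rfl⟩ : ∃ r, t = r + 1 := ⟨t - 1, by omega⟩
              rw [pow_succ', ← Nat.div_div_eq_div_mul, ← Nat.div_div_eq_div_mul]
              congr 1
              omega
            rw [hdiv] at h3
            omega
          · obtain rfl : t = 1 := by omega
            rw [if_pos (by rw [Finset.mem_Ico]; omega)] at this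
            omega)
      refine ⟨u, fun s => a' s - u s, 1, by omega, ?_, Or.inr ⟨rfl, hi⟩, fun s _ => ?_⟩
      · have : ∑ s ∈ Finset.range (i + 1), u s * 2 ^ s +
            ∑ s ∈ Finset.range (i + 1), (a' s - u s) * 2 ^ s = 2 * N + 2 * N := by
          rw [← htot', ← Finset.sum_add_distrib]
          refine Finset.sum_congr rfl fun s _ => ?_
          rw [← add_mul, Nat.add_sub_cancel' (hu s)]
        beta_reduce
        omega
      · have := hu s
        have h2 := haa s
        simp only [true_and]
        omega

/-! ### Passing to `b` and to base-`m` digits. -/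

/-- Admissible multisets correspond bijectively to their count sequences, because these vanish
beyond `i`. -/
theorem b_modEq_of_boundedCounts {m : ℕ} (hm : 2 ≤ m) (i n : ℕ) (M : ℕ → ℕ)
    (hM : ∀ t, t < i → m * M (t + 1) ≤ M t)
    (h : ∀ a : ℕ → ℕ, (∀ s, i < s → a s = 0) →
      (IsPartition 2 n (ofCounts m i a) ↔ BoundedCounts m i M a)) :
    b m i 0 n ≡ ∏ l ∈ Finset.Icc 1 i, (M l + 1) [MOD m] := by
  obtain ⟨F, hF, hc⟩ := exists_finset_boundedCounts (by omega) i M hM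
  have hset : {P : Multiset (Sym2 ℕ) | IsPartition 2 n P ∧ ∀ B ∈ P, B ∈ allowedSizes m i 0} =
      ofCounts m i '' F := by
    ext P
    simp only [Set.mem_ofPred_eq, Set.mem_image, Finset.mem_coe]
    constructor
    · rintro ⟨hP, hB⟩
      have hB : ∀ B ∈ P, ∃ s, s ≤ i ∧ B = s(1, m ^ s) := by
        intro B h
        rcases hB B h with h | ⟨t, h1, h2, -⟩
        · exact h
        · omega
      have e : ofCounts m i (fun s => if i < s then 0 else P.count s(1, m ^ s)) = P := by
        rw [← sum_replicate_count (one_sym_pow_injective hm) hB, ofCounts]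
        refine Finset.sum_congr rfl fun s hs => ?_
        rw [if_neg (by have := Finset.mem_range.1 hs; omega),
          sum_replicate_count (one_sym_pow_injective hm) hB]
      refine ⟨_, ?_, e⟩
      rw [hF, ← h _ fun s hs => if_pos hs, e]
      exact hP
    · rintro ⟨a, ha, rfl⟩
      have ha := (hF a).1 ha
      exact ⟨(h a ha.1).2 ha, fun B hB => Or.inl (mem_ofCounts hB)⟩
  have hinj : Set.InjOn (ofCounts m i) F := by
    intro a ha a' ha' h
    have ha := (hF a).1 ha
    have ha' := (hF a').1 ha'
    funext s
    rcases Nat.lt_or_ge i s with hs | hs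
    · rw [ha.1 s hs, ha'.1 s hs]
    · have e := congrArg (Multiset.count s(1, m ^ s)) h
      rwa [ofCounts, ofCounts, count_sum_replicate (one_sym_pow_injective hm) hs,
        count_sum_replicate (one_sym_pow_injective hm) hs] at e
  rw [b, hset, hinj.ncard_image, Set.ncard_coe_finset]
  exact hc

theorem sum_digits_div_mod {m : ℕ} (t : ℕ) (K : ℕ) (c : ℕ → ℕ) (hc : ∀ l, c l < m)
    (h0 : ∀ s, K ≤ s → c s = 0) :
    (∑ l ∈ Finset.range K, c l * m ^ l) / m ^ t % m = c t := by
  have hm : 0 < m := (Nat.zero_le _).trans_lt (hc 0)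
  induction t generalizing K c with
  | zero =>
    cases K with
    | zero => simp [h0]
    | succ K =>
      rw [Finset.sum_range_succ']
      simp only [pow_succ, ← mul_assoc, ← Finset.sum_mul]
      simp [Nat.mod_eq_of_lt (hc 0)]
  | succ t ih =>
    cases K with
    | zero => simp [h0]
    | succ K =>
      rw [← ih K (fun l => c (l + 1)) (fun l => hc _) (fun s hs => h0 _ (by omega)),
        Finset.sum_range_succ', pow_succ', ← Nat.div_div_eq_div_mul]
      simp only [pow_succ, ← mul_assoc, ← Finset.sum_mul]
      rw [pow_zero, mul_one, add_comm, Nat.add_mul_div_right _ _ hm,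
        Nat.div_eq_of_lt (hc 0), zero_add]

theorem mul_two_div_pow_succ_le (m n t : ℕ) : m * (2 * (n / m ^ (t + 1))) ≤ 2 * (n / m ^ t) := by
  rw [pow_succ, ← Nat.div_div_eq_div_mul, mul_left_comm]
  exact Nat.mul_le_mul_left _ (Nat.mul_div_le _ _)

end RectPartition

open RectPartition in
theorem mainTheorem7 :
    (∀ m i n k : ℕ, ∀ c : ℕ → ℕ, 3 ≤ m →
      (∀ l, c l < m) → (∀ s, k < s → c s = 0) →
      n = ∑ l ∈ Finset.range (k + 1), c l * m ^ l →
      RectPartition.b m i 0 n ≡ ∏ l ∈ Finset.Icc 1 i, (2 * c l + 1) [MOD m]) ∧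
    (∀ m i n k : ℕ, ∀ c : ℕ → ℕ, m = 2 → 1 ≤ i →
      (∀ l, c l < m) → (∀ s, k < s → c s = 0) →
      n = ∑ l ∈ Finset.range (k + 1), c l * m ^ l →
      RectPartition.b m i 0 n ≡ c 0 + 1 [MOD m]) := by
  constructor
  · intro m i n k c hm hc h0 hn
    refine (b_modEq_of_boundedCounts (by omega) i n (fun t => 2 * (n / m ^ t))
      (fun t _ => mul_two_div_pow_succ_le m n t)
      (isPartition_iff_boundedCounts hm i n)).trans ?_
    rw [← ZMod.natCast_eq_natCast_iff]
    push_cast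
    refine Finset.prod_congr rfl fun l _ => ?_
    have h := sum_digits_div_mod l (k + 1) c hc fun s hs => h0 s hs
    rw [← hn] at h
    rw [← h, ZMod.natCast_mod]
  · rintro m i n k c rfl hi hc h0 hn
    refine (b_modEq_of_boundedCounts le_rfl i n (fun t => if t = 1 then n else 2 * (n / 2 ^ t))
      ?_ (isPartition_iff_boundedCounts_two hi n)).trans ?_
    · intro t _
      rcases t with _ | _ | t
      · simp
      · simp
        omega
      · simpa using mul_two_div_pow_succ_le 2 n (t + 2)
    · have h := sum_digits_div_mod 0 (k + 1) c hc fun s hs => h0 s hs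
      rw [← hn, pow_zero, Nat.div_one] at h
      -- The target is spread over the same index set so that factors compare one by one: `n + 1`
      -- with `c 0 + 1` at `l = 1`, an odd number with `1` elsewhere.
      have hprod : c 0 + 1 = ∏ l ∈ Finset.Icc 1 i, if l = 1 then c 0 + 1 else 1 := by
        rw [Finset.prod_ite_eq', if_pos (Finset.mem_Icc.2 ⟨le_rfl, hi⟩)]
      rw [hprod, ← ZMod.natCast_eq_natCast_iff, Nat.cast_prod, Nat.cast_prod]
      refine Finset.prod_congr rfl fun l _ => ?_
      rw [ZMod.natCast_eq_natCast_iff, Nat.ModEq]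
      split_ifs <;> omega
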